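/- Say that a group $H$ has the factorization property if for every homomorphism $f : H \to P$ to a finite group $P$ there are a torsion-free elementary amenable group $M$ and homomorphisms $h : H \to M$ and $g : M \to P$ with $f = g \circ h$. Here a group is torsion-free if its only element of finite order is the identity, and the class of elementary amenable groups is the smallest class of groups that contains all finite groups and all abelian groups and is closed under isomorphism and under taking subgroups, quotients, extensions and directed unions. Let $\Gamma$ be a finite simplicial graph with vertex set $S$, and let $(G_s)_{s \in S}$ be a family of groups. The graph product $G_\Gamma$ is the quotient of the free product of the groups $G_s$ ($s \in S$) by the normal subgroup generated by all commutators $[g_s, g_t]$ with $g_s \in G_s$, $g_t \in G_t$, where $s$ and $t$ span an edge of $\Gamma$. Theorem. If every vertex group $G_s$ ($s \in S$) has the factorization property, then the graph product $G_\Gamma$ has the factorization property. -/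

import Mathlib

open scoped commutatorElement

universe u v

/-- A group is torsion-free if the identity is its only element of finite order.
(Mathlib's `IsMulTorsionFree`, injectivity of all power maps, is strictly stronger for
non-commutative groups.) -/
def IsTorsionFreeGroup (G : Type u) [Group G] : Prop :=
  ∀ g : G, IsOfFinOrder g → g = 1

/-- The class of elementary amenable groups: the smallest class of groups containing all finite
and all abelian groups and closed under subgroups, quotients, extensions and directed unions.
Subgroups and quotients are given as injective and surjective homomorphisms, so that the class is
also closed under isomorphism. -/
inductive IsElementaryAmenable : ∀ (G : Type u) [Group G], Prop
  | of_finite (G : Type u) [Group G] [Finite G] : IsElementaryAmenable G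
  | of_comm (G : Type u) [Group G] (comm : ∀ a b : G, a * b = b * a) : IsElementaryAmenable G
  | of_injective {G H : Type u} [Group G] [Group H] (f : H →* G) (hf : Function.Injective f)
      (hG : IsElementaryAmenable G) : IsElementaryAmenable H
  | of_surjective {G H : Type u} [Group G] [Group H] (f : G →* H) (hf : Function.Surjective f)
      (hG : IsElementaryAmenable G) : IsElementaryAmenable H
  | of_extension {G : Type u} [Group G] (N : Subgroup G) [N.Normal]
      (hN : IsElementaryAmenable N) (hQ : IsElementaryAmenable (G ⧸ N)) : IsElementaryAmenable G
  | of_directed_union {G : Type u} [Group G] (𝒦 : Set (Subgroup G))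
      (directed : DirectedOn (· ≤ ·) 𝒦) (cover : ∀ g : G, ∃ K ∈ 𝒦, g ∈ K)
      (hK : ∀ K ∈ 𝒦, IsElementaryAmenable K) : IsElementaryAmenable G

/-- A group `H` has the factorization property if every homomorphism from `H` to a finite group
factors through a torsion-free elementary amenable group. -/
def HasFactorizationProperty (H : Type u) [Group H] : Prop :=
  ∀ (P : Type u) [Group P] [Finite P] (f : H →* P),
    ∃ (M : Type u) (_ : Group M), IsTorsionFreeGroup M ∧ IsElementaryAmenable M ∧
      ∃ (h : H →* M) (g : M →* P), f = g.comp h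

/-- The commutators `[a, b]` in the free product of the vertex groups, where `a` and `b` lie in
vertex groups at adjacent vertices. -/
def graphProductRelators {S : Type u} (Γ : SimpleGraph S) (G : S → Type v)
    [∀ s, Group (G s)] : Set (Monoid.CoprodI G) :=
  {x | ∃ s t : S, Γ.Adj s t ∧ ∃ (a : G s) (b : G t),
    x = ⁅(Monoid.CoprodI.of a : Monoid.CoprodI G), (Monoid.CoprodI.of b : Monoid.CoprodI G)⁆}

/-- The graph product of the groups `G s` over the graph `Γ`: the quotient of their free product
by the normal subgroup generated by the commutators of elements of adjacent vertex groups. -/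
abbrev GraphProduct {S : Type u} (Γ : SimpleGraph S) (G : S → Type v)
    [∀ s, Group (G s)] : Type (max u v) :=
  Monoid.CoprodI G ⧸ Subgroup.normalClosure (graphProductRelators Γ G)

/-!
The proof rests on one criterion (`hasFactorizationProperty_of_free_ker`): a group `E` with a
homomorphism `ρ` to a torsion-free elementary amenable group `A` whose kernel is free has the
factorization property. Given `ψ : E → P` with `P` finite, let `K` be the kernel of
`(ρ, ψ) : E → A × P`. Then `ψ` factors through `E / [K, K]`, an extension of a subgroup of `A × P`
by an abelian group. It is torsion-free: if a power of `x` is in `[K, K]`, then `ρ x = 1`, so the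
group `H` generated by `K` and `x` is free by the Nielsen–Schreier theorem, and its abelianization
is torsion-free. Hence `x ∈ [H, H]`, which is contained in `K` as `H / K` is cyclic; now the
abelianization of the free group `K` is torsion-free, so `x ∈ [K, K]`.

Given a homomorphism from the graph product to `P`, suitable homomorphisms from the vertex groups
to a torsion-free elementary amenable group over `P` are constructed one vertex at a time. Let `M`
be the group obtained so far, `V` a torsion-free elementary amenable group through which the next
vertex group maps onto its image, and `L ≤ M` the subgroup generated by the images of the vertex
groups at the neighbours. The amalgam of `M` and `L × V` over `L` is the semidirect product of `M`
with the free product of copies of `V` indexed by `M / L`. It maps to `P`, so by the criterion it is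
enough that the kernel of its projection to `V × M` is free. This is the kernel of the fold map from
the free product to `V`, and it is free because sending the copy with index `y` to the conjugate
`y V y⁻¹` embeds the free product in the free product of `V` with the free group on `M / L`
(`FreePower.toFree_injective`), where the projection to `V` has as kernel the free group on the
conjugates of the generators.
-/

/-! ### Closure properties of elementary amenable groups -/

/-- A subgroup is isomorphic to its preimage under an isomorphism. -/
noncomputable def MulEquiv.comapSubgroupEquiv {G : Type u} {H : Type v} [Group G] [Group H]
    (e : G ≃* H) (K : Subgroup H) : K.comap e.toMonoidHom ≃* K :=
  (e.subgroupMap _).trans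
    (MulEquiv.subgroupCongr (Subgroup.map_comap_eq_self_of_surjective e.surjective K))

namespace IsElementaryAmenable

theorem of_ker {G H : Type u} [Group G] [Group H] (f : G →* H)
    (hker : IsElementaryAmenable f.ker) (hH : IsElementaryAmenable H) :
    IsElementaryAmenable G :=
  of_extension f.ker hker
    (of_injective (QuotientGroup.kerLift f) (QuotientGroup.kerLift_injective f) hH)

theorem prod {G H : Type u} [Group G] [Group H] (hG : IsElementaryAmenable G)
    (hH : IsElementaryAmenable H) : IsElementaryAmenable (G × H) := by
  refine of_ker (MonoidHom.fst G H) (of_injective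
    ((MonoidHom.snd G H).comp (MonoidHom.fst G H).ker.subtype) ?_ hH) hG
  rintro ⟨⟨a, b⟩, ha⟩ ⟨⟨c, d⟩, hc⟩ h
  simp only [MonoidHom.mem_ker, MonoidHom.coe_fst] at ha hc
  simp_all

/-- Elementary amenability passes to isomorphic groups in larger universes. -/
theorem of_mulEquiv_max {G : Type v} [Group G] (hG : IsElementaryAmenable G) :
    ∀ {G' : Type (max u v)} [Group G'], (G' ≃* G) → IsElementaryAmenable G' := by
  induction hG with
  | of_finite G =>
    intro G' _ e
    have := Finite.of_equiv G e.symm.toEquiv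
    exact of_finite G'
  | of_comm G comm =>
    intro G' _ e
    exact of_comm G' fun a b => e.injective (by simp [comm])
  | @of_injective G H _ _ f hf _ ih =>
    intro G' _ e
    exact of_injective (G := ULift.{u} G) (H := G')
      (MulEquiv.ulift.symm.toMonoidHom.comp (f.comp e.toMonoidHom))
      (MulEquiv.ulift.symm.injective.comp (hf.comp e.injective)) (ih MulEquiv.ulift)
  | @of_surjective G H _ _ f hf _ ih =>
    intro G' _ e
    exact of_surjective (G := ULift.{u} G) (H := G')
      (e.symm.toMonoidHom.comp (f.comp (MulEquiv.ulift (α := G)).toMonoidHom))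
      (e.symm.surjective.comp (hf.comp (MulEquiv.ulift (α := G)).surjective)) (ih MulEquiv.ulift)
  | @of_extension G _ N _ _ _ ihN ihQ =>
    intro G' _ e
    exact of_extension (N.comap e.toMonoidHom)
      (ihN (e.comapSubgroupEquiv N)) (ihQ (QuotientGroup.congr _ N e (by
        exact Subgroup.map_comap_eq_self_of_surjective e.surjective N)))
  | @of_directed_union G _ 𝒦 directed cover _ ih =>
    intro G' _ e
    refine of_directed_union ((fun K : Subgroup G => K.comap e.toMonoidHom) '' 𝒦) ?_ ?_ ?_
    · rintro _ ⟨K, hK, rfl⟩ _ ⟨L, hL, rfl⟩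
      obtain ⟨N, hN, hKN, hLN⟩ := directed K hK L hL
      exact ⟨_, ⟨N, hN, rfl⟩, Subgroup.comap_mono hKN, Subgroup.comap_mono hLN⟩
    · intro g
      obtain ⟨K, hK, hg⟩ := cover (e g)
      exact ⟨_, ⟨K, hK, rfl⟩, hg⟩
    · rintro _ ⟨K, hK, rfl⟩
      exact ih K hK (e.comapSubgroupEquiv K)

end IsElementaryAmenable

theorem IsTorsionFreeGroup.of_injective {G : Type u} {H : Type v} [Group G] [Group H]
    (f : G →* H) (hf : Function.Injective f) (hH : IsTorsionFreeGroup H) :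
    IsTorsionFreeGroup G := fun _ hg =>
  hf ((hH _ (f.isOfFinOrder hg)).trans f.map_one.symm)

theorem IsTorsionFreeGroup.prod {G : Type u} {H : Type v} [Group G] [Group H]
    (hG : IsTorsionFreeGroup G) (hH : IsTorsionFreeGroup H) : IsTorsionFreeGroup (G × H) :=
  fun _ hg => Prod.ext (hG _ ((MonoidHom.fst G H).isOfFinOrder hg))
    (hH _ ((MonoidHom.snd G H).isOfFinOrder hg))

/-! ### Commutator quotients over free kernels -/

theorem IsFreeGroup.of_injective {G F : Type u} [Group G] [Group F] [IsFreeGroup F]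
    (j : G →* F) (hj : Function.Injective j) : IsFreeGroup G :=
  IsFreeGroup.ofMulEquiv (MonoidHom.ofInjective hj).symm

theorem FreeGroup.mem_commutator_of_pow_mem {X : Type u} {x : FreeGroup X} {n : ℕ} (hn : n ≠ 0)
    (hx : x ^ n ∈ commutator (FreeGroup X)) : x ∈ commutator (FreeGroup X) := by
  have : IsAddTorsionFree (FreeAbelianGroup X) :=
    (FreeAbelianGroup.equivFinsupp X).injective.isAddTorsionFree
      (FreeAbelianGroup.equivFinsupp X).toAddMonoidHom
  rw [← Abelianization.ker_of, MonoidHom.mem_ker] at hx ⊢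
  rw [map_pow] at hx
  have key (y : FreeAbelianGroup X) : n • y = 0 → y = 0 := (nsmul_eq_zero_iff_right hn).1
  exact key _ hx

theorem Subgroup.mem_commutator_self_of_pow_mem {G : Type u} [Group G] (H : Subgroup G)
    [IsFreeGroup H] {x : G} (hxH : x ∈ H) {n : ℕ} (hn : n ≠ 0) (hx : x ^ n ∈ ⁅H, H⁆) :
    x ∈ ⁅H, H⁆ := by
  rw [← Subgroup.map_subtype_commutator] at hx ⊢
  obtain ⟨y, hy, hyx⟩ := hx
  refine ⟨⟨x, hxH⟩, ?_, rfl⟩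
  obtain rfl : y = ⟨x, hxH⟩ ^ n := Subtype.ext hyx
  have key : IsFreeGroup.toFreeGroup H ⟨x, hxH⟩ ∈ _root_.commutator (FreeGroup _) :=
    FreeGroup.mem_commutator_of_pow_mem hn (by
      rw [← map_pow]
      have := Subgroup.mem_map_of_mem (IsFreeGroup.toFreeGroup H).toMonoidHom hy
      rw [_root_.commutator_def, Subgroup.map_commutator] at this
      exact Subgroup.commutator_mono le_top le_top this)
  have := Subgroup.mem_map_of_mem (IsFreeGroup.toFreeGroup H).symm.toMonoidHom key
  rw [_root_.commutator_def, Subgroup.map_commutator] at this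
  rw [_root_.commutator_def]
  simpa using Subgroup.commutator_mono le_top le_top this

/-- A group that maps to a torsion-free elementary amenable group with free kernel has the
factorization property. The kernel is free as soon as it embeds in a free group. -/
theorem hasFactorizationProperty_of_free_ker {E A F : Type u} [Group E] [Group A] [Group F]
    [IsFreeGroup F] (hA : IsTorsionFreeGroup A) (hA' : IsElementaryAmenable A) (ρ : E →* A)
    (j : ρ.ker →* F) (hj : Function.Injective j) : HasFactorizationProperty E := by
  intro P _ _ ψ
  have hfree (H : Subgroup E) (hH : H ≤ ρ.ker) : IsFreeGroup H :=
    IsFreeGroup.of_injective (j.comp (Subgroup.inclusion hH))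
      (hj.comp (Subgroup.inclusion_injective hH))
  set σ : E →* A × P := ρ.prod ψ with hσ
  have hKρ : σ.ker ≤ ρ.ker := fun x hx => congrArg Prod.fst (MonoidHom.mem_ker.1 hx)
  have hNK : ⁅σ.ker, σ.ker⁆ ≤ σ.ker := Subgroup.commutator_le_left _ _
  refine ⟨E ⧸ ⁅σ.ker, σ.ker⁆, inferInstance, ?_, ?_, QuotientGroup.mk' _,
    (MonoidHom.snd A P).comp (QuotientGroup.lift _ σ hNK), ?_⟩
  · intro q hq
    obtain ⟨x, rfl⟩ := QuotientGroup.mk_surjective q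
    obtain ⟨n, hn, hx⟩ := isOfFinOrder_iff_pow_eq_one.1 hq
    rw [← QuotientGroup.mk_pow, QuotientGroup.eq_one_iff] at hx
    rw [QuotientGroup.eq_one_iff]
    have hxρ : x ∈ ρ.ker := hA _ (isOfFinOrder_iff_pow_eq_one.2
      ⟨n, hn, by rw [← map_pow]; exact hKρ (hNK hx)⟩)
    -- The image of `σ.ker ⊔ ⟨x⟩` under `σ` is cyclic, so its commutator subgroup is in `σ.ker`.
    set H : Subgroup E := (Subgroup.zpowers (σ x)).comap σ with hH
    have hHρ : H ≤ ρ.ker := by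
      rintro y ⟨k, hk⟩
      have := congrArg Prod.fst hk
      simpa [hσ, MonoidHom.mem_ker.1 hxρ, MonoidHom.mem_ker, eq_comm] using this
    have hHK : ⁅H, H⁆ ≤ σ.ker := by
      rw [Subgroup.commutator_le]
      intro a ha b hb
      rw [MonoidHom.mem_ker, map_commutatorElement, commutatorElement_eq_one_iff_commute]
      obtain ⟨k, hk⟩ := ha
      obtain ⟨l, hl⟩ := hb
      rw [← hk, ← hl]
      exact Commute.zpow_zpow_self _ _ _
    have hKH : σ.ker ≤ H := fun y hy => by
      rw [hH, Subgroup.mem_comap, MonoidHom.mem_ker.1 hy]; exact one_mem _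
    have := hfree H hHρ
    have := hfree _ hKρ
    exact Subgroup.mem_commutator_self_of_pow_mem _
      (hHK (Subgroup.mem_commutator_self_of_pow_mem H (Subgroup.mem_zpowers _) hn.ne'
        (Subgroup.commutator_mono hKH hKH hx))) hn.ne' hx
  · refine .of_ker (QuotientGroup.lift _ σ hNK) (.of_comm _ ?_) (hA'.prod (.of_finite P))
    rintro ⟨p, hp⟩ ⟨q, hq⟩
    obtain ⟨x, rfl⟩ := QuotientGroup.mk_surjective p
    obtain ⟨y, rfl⟩ := QuotientGroup.mk_surjective q
    refine Subtype.ext (QuotientGroup.eq.2 ?_)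
    have h := Subgroup.commutator_mem_commutator (inv_mem (show y ∈ σ.ker from hq))
      (inv_mem (show x ∈ σ.ker from hp))
    simpa [commutatorElement_def, mul_assoc] using h
  · ext x; simp [hσ]

/-! ### Free powers and their permutational extensions -/

open Monoid SemidirectProduct

/-- The free product of copies of the group `V` indexed by `Y`. -/
abbrev FreePower (Y V : Type u) [Group V] : Type u := CoprodI fun _ : Y => V

namespace FreePower

variable {Y V : Type u} [Group V]

/-- The inclusion of the copy of `V` with index `y`. -/
abbrev of (y : Y) : V →* FreePower Y V := CoprodI.of (M := fun _ : Y => V) (i := y)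

/-- The map of free powers induced by a map of index sets. -/
def map {Z : Type u} (e : Y → Z) : FreePower Y V →* FreePower Z V :=
  CoprodI.lift fun y => of (e y)

@[simp]
theorem map_of {Z : Type u} (e : Y → Z) (y : Y) (v : V) : map e (of y v) = of (e y) v :=
  CoprodI.lift_of _ _

theorem map_map {Z W : Type u} (e : Y → Z) (e' : Z → W) (x : FreePower Y V) :
    map e' (map e x) = map (e' ∘ e) x :=
  DFunLike.congr_fun (CoprodI.ext_hom ((map e').comp (map e)) (map (e' ∘ e)) fun y => by
    ext v; simp) x

theorem map_id (x : FreePower Y V) : map id x = x :=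
  DFunLike.congr_fun (CoprodI.ext_hom (map id) (MonoidHom.id _) fun y => by ext v; simp) x

variable (Y V) in
/-- Permutations of the index set act on a free power by permuting the factors. -/
def perm : Equiv.Perm Y →* MulAut (FreePower Y V) where
  toFun e := MonoidHom.toMulEquiv (map e) (map e.symm)
    (by ext y v; simp) (by ext y v; simp)
  map_one' := MulEquiv.ext map_id
  map_mul' e e' := MulEquiv.ext fun x => (map_map e' e x).symm

@[simp]
theorem perm_of (e : Equiv.Perm Y) (y : Y) (v : V) : perm Y V e (of y v) = of (e y) v :=
  map_of _ _ _

variable (Y V) in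
/-- The fold map, which is the identity of `V` on each factor. -/
def fold : FreePower Y V →* V := CoprodI.lift fun _ => MonoidHom.id V

@[simp]
theorem fold_of (y : Y) (v : V) : fold Y V (of y v) = v := CoprodI.lift_of _ _

@[simp]
theorem fold_perm (e : Equiv.Perm Y) (x : FreePower Y V) :
    fold Y V (perm Y V e x) = fold Y V x :=
  DFunLike.congr_fun (CoprodI.ext_hom
    ((fold Y V).comp (perm Y V e).toMonoidHom) (fold Y V) fun y => by ext v; simp) x

variable (Y V) in
/-- The action of `V` on the free group on `V × Y` by left translation of the first coordinate.
The semidirect product is the free product of `V` with the free group on `Y`, where `y` stands for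
the generator `(1, y)` and `(v, y)` for its conjugate by `v`. -/
def translation : V →* MulAut (FreeGroup (V × Y)) where
  toFun v := FreeGroup.freeGroupCongr ((Equiv.mulLeft v).prodCongr (Equiv.refl Y))
  map_one' := by
    refine MulEquiv.toMonoidHom_injective (FreeGroup.ext_hom _ _ fun p => ?_)
    simp
  map_mul' v w := by
    refine MulEquiv.toMonoidHom_injective (FreeGroup.ext_hom _ _ fun p => ?_)
    simp [mul_assoc, Prod.map]

@[simp]
theorem translation_of (v : V) (p : V × Y) :
    translation Y V v (FreeGroup.of p) = FreeGroup.of (v * p.1, p.2) := by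
  simp [translation, Prod.map]

variable (Y V) in
/-- The homomorphism sending the factor with index `y` to the conjugate of `V` by the free
generator `y`. -/
def toFree : FreePower Y V →* FreeGroup (V × Y) ⋊[translation Y V] V :=
  CoprodI.lift fun y =>
    (MulAut.conj (inl (FreeGroup.of ((1 : V), y)))).toMonoidHom.comp inr

@[simp]
theorem toFree_of (y : Y) (v : V) : toFree Y V (of y v) =
    inl (FreeGroup.of (1, y)) * inr v * (inl (FreeGroup.of (1, y)))⁻¹ :=
  CoprodI.lift_of _ _

@[simp]
theorem toFree_right (x : FreePower Y V) : (toFree Y V x).right = fold Y V x :=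
  DFunLike.congr_fun (CoprodI.ext_hom (rightHom.comp (toFree Y V)) (fold Y V) fun y => by
    ext v; simp) x

/-- Composing `toFree` with the homomorphism to `FreePower Y V ⋊ Equiv.Perm Y` that sends `V` to
the factor with index `y₀` and the free generator `y` to the transposition of `y₀` and `y` gives
the inclusion of the free power, since the transposition conjugates the factor with index `y₀` to
the one with index `y`. -/
theorem toFree_injective [Nonempty Y] : Function.Injective (toFree Y V) := by
  classical
  obtain ⟨y₀⟩ := ‹Nonempty Y›
  let β : FreeGroup (V × Y) ⋊[translation Y V] V →* FreePower Y V ⋊[perm Y V] Equiv.Perm Y :=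
    SemidirectProduct.lift
      (FreeGroup.lift fun p =>
        inl (of y₀ p.1) * inr (Equiv.swap y₀ p.2) * (inl (of y₀ p.1))⁻¹)
      (inl.comp (of y₀)) fun w => by
        ext p : 1
        simp [mul_assoc]
  have h : β.comp (toFree Y V) = inl := CoprodI.ext_hom _ _ fun y => by
    ext v : 1
    have := inl_aut (φ := perm Y V) (Equiv.swap y₀ y) (of y₀ v)
    simp only [perm_of, Equiv.swap_apply_left, map_inv] at this
    simp [β, this]
  have h' : Function.Injective (β ∘ toFree Y V) := by
    rw [← MonoidHom.coe_comp, h]; exact inl_injective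
  exact h'.of_comp

/-- The semidirect product maps to `V × M` by the fold map and the projection, and `toFree` embeds
the kernel in a free group. -/
theorem hasFactorizationProperty_semidirectProduct [Nonempty Y] {M : Type u} [Group M]
    (hV : IsTorsionFreeGroup V) (hV' : IsElementaryAmenable V) (hM : IsTorsionFreeGroup M)
    (hM' : IsElementaryAmenable M) (φ : M →* Equiv.Perm Y) :
    HasFactorizationProperty (FreePower Y V ⋊[(perm Y V).comp φ] M) := by
  let ρ : FreePower Y V ⋊[(perm Y V).comp φ] M →* V × M :=
    (SemidirectProduct.lift (fold Y V) 1 fun m => by ext; simp).prod rightHom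
  have hρ (k : ρ.ker) : fold Y V k.1.left = 1 ∧ k.1.right = 1 := by
    have h := MonoidHom.mem_ker.1 k.2
    exact ⟨by simpa [ρ, SemidirectProduct.lift] using congrArg Prod.fst h, congrArg Prod.snd h⟩
  refine hasFactorizationProperty_of_free_ker (hV.prod hM) (hV'.prod hM') ρ
    (MonoidHom.mk' (fun k => (toFree Y V k.1.left).left) fun a b => ?_) fun a b hab => ?_
  · simp [hρ]
  · refine Subtype.ext (SemidirectProduct.ext (toFree_injective
      (SemidirectProduct.ext hab ?_)) ?_) <;> simp [hρ]

end FreePower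

/-! ### Graph products -/

/-- The group of the conclusion is a quotient of the amalgam of `M` and `L × V` over `L`, realized
as the semidirect product of `M` with the free product of copies of `V` indexed by `M ⧸ L`. -/
theorem exists_extension_of_commute {M V P : Type u} [Group M] [Group V] [Group P] [Finite P]
    (hM : IsTorsionFreeGroup M) (hM' : IsElementaryAmenable M)
    (hV : IsTorsionFreeGroup V) (hV' : IsElementaryAmenable V) (L : Subgroup M)
    (g : M →* P) (k : V →* P) (hgk : ∀ l ∈ L, ∀ v, Commute (g l) (k v)) :
    ∃ (M' : Type u) (_ : Group M'), IsTorsionFreeGroup M' ∧ IsElementaryAmenable M' ∧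
      ∃ (i : M →* M') (j : V →* M') (g' : M' →* P), g'.comp i = g ∧ g'.comp j = k ∧
        ∀ l ∈ L, ∀ v, Commute (i l) (j v) := by
  let φ := MulAction.toPermHom M (M ⧸ L)
  let κ (y : M ⧸ L) : V →* P := (MulAut.conj (g y.out)).toMonoidHom.comp k
  have hκ (m : M) (v : V) : κ (m : M ⧸ L) v = g m * k v * (g m)⁻¹ := by
    obtain ⟨l, hl⟩ := QuotientGroup.mk_out_eq_mul L m
    have h := (hgk l l.2 v).eq
    change g (m : M ⧸ L).out * k v * (g (m : M ⧸ L).out)⁻¹ = _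
    rw [hl, map_mul, mul_inv_rev, mul_assoc (g m), h]
    group
  let ψ : FreePower (M ⧸ L) V ⋊[(FreePower.perm _ V).comp φ] M →* P :=
    SemidirectProduct.lift (CoprodI.lift κ) g fun m => CoprodI.ext_hom _ _ fun y => by
      obtain ⟨x, rfl⟩ := QuotientGroup.mk_surjective y
      ext v
      have : φ m (x : M ⧸ L) = ((m * x : M) : M ⧸ L) := rfl
      simp [this, hκ, mul_assoc]
  obtain ⟨M', _, h₁, h₂, h, g', hψ⟩ :=
    FreePower.hasFactorizationProperty_semidirectProduct hV hV' hM hM' φ P ψ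
  refine ⟨M', _, h₁, h₂, h.comp inr, h.comp (inl.comp (FreePower.of ((1 : M) : M ⧸ L))), g',
    ?_, ?_, fun l hl v => ?_⟩
  · rw [← MonoidHom.comp_assoc, ← hψ]
    exact SemidirectProduct.lift_comp_inr _ _ _
  · rw [← MonoidHom.comp_assoc, ← hψ]
    ext v
    simp [ψ, hκ]
  · refine Commute.map (f := h) ?_
    have hφ : φ l ((1 : M) : M ⧸ L) = ((1 : M) : M ⧸ L) :=
      QuotientGroup.eq.2 (by simpa using hl)
    have := inl_aut (φ := (FreePower.perm (M ⧸ L) V).comp φ) l (FreePower.of ((1 : M) : M ⧸ L) v)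
    rw [MonoidHom.comp_apply, FreePower.perm_of, hφ, map_inv, eq_mul_inv_iff_mul_eq] at this
    exact this.symm

/-- By induction on `T`: adding a vertex `v` is `exists_extension_of_commute`, for the subgroup of
the group built so far that is generated by the images of the groups at the neighbours of `v`. -/
theorem exists_factorization_of_finset {S : Type u} (Γ : SimpleGraph S) {G : S → Type v}
    [∀ s, Group (G s)] (hG : ∀ s, HasFactorizationProperty (G s)) {P : Type v} [Group P] [Finite P]
    (f : ∀ s, G s →* P) (hf : ∀ s t, Γ.Adj s t → ∀ a b, Commute (f s a) (f t b)) (T : Finset S) :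
    ∃ (M : Type v) (_ : Group M), IsTorsionFreeGroup M ∧ IsElementaryAmenable M ∧
      ∃ (h : ∀ s, G s →* M) (g : M →* P), (∀ s ∈ T, g.comp (h s) = f s) ∧
        ∀ s ∈ T, ∀ t ∈ T, Γ.Adj s t → ∀ a b, Commute (h s a) (h t b) := by
  classical
  induction T using Finset.induction_on with
  | empty =>
    exact ⟨PUnit, inferInstance, fun _ _ => rfl, .of_finite _, fun _ => 1, 1, by simp, by simp⟩
  | insert v T hv ih =>
    obtain ⟨M, _, hM, hM', h, g, hgh, hcomm⟩ := ih
    obtain ⟨V, _, hV, hV', p, q, hpq⟩ := hG v P (f v)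
    let L : Subgroup M := ⨆ s : {s // s ∈ T ∧ Γ.Adj s v}, (h s).range
    -- The image of `V` itself in `P` need not commute with the image of `L`, so `V` is replaced by
    -- the image of `G v`.
    obtain ⟨M', _, hM₁, hM₂, i, j, g', hi, hj, hij⟩ := exists_extension_of_commute hM hM'
      (hV.of_injective p.range.subtype p.range.subtype_injective)
      (.of_injective p.range.subtype p.range.subtype_injective hV') L g (q.comp p.range.subtype)
      (by
        rintro l hl ⟨_, a, rfl⟩
        have hL : L ≤ (Subgroup.centralizer {q (p a)}).comap g := by
          refine iSup_le ?_
          rintro ⟨s, hs, hadj⟩ _ ⟨b, rfl⟩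
          have := hf s v hadj b a
          rw [← hgh s hs, hpq] at this
          rw [Subgroup.mem_comap, Subgroup.mem_centralizer_singleton_iff]
          exact this.eq
        exact Subgroup.mem_centralizer_singleton_iff.1 (hL hl))
    have hnew (s) (hs : s ∈ T) (hadj : Γ.Adj s v) (a : G s) (b : G v) :
        Commute (i (h s a)) (j (p.rangeRestrict b)) :=
      hij _ (Subgroup.mem_iSup_of_mem (⟨s, hs, hadj⟩ : {s // s ∈ T ∧ Γ.Adj s v}) ⟨a, rfl⟩) _
    have hne {s} (hs : s ∈ T) : s ≠ v := by rintro rfl; exact hv hs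
    refine ⟨M', _, hM₁, hM₂,
      Function.update (fun s => i.comp (h s)) v (j.comp p.rangeRestrict), g', ?_, ?_⟩
    · intro s hs
      rcases Finset.mem_insert.1 hs with rfl | hs
      · rw [Function.update_self, ← MonoidHom.comp_assoc, hj, hpq]
        rfl
      · rw [Function.update_of_ne (hne hs), ← MonoidHom.comp_assoc, hi, hgh s hs]
    · intro s hs t ht hadj a b
      rcases Finset.mem_insert.1 hs with rfl | hs₁ <;>
        rcases Finset.mem_insert.1 ht with rfl | ht₁
      · exact (Γ.irrefl hadj).elim
      · rw [Function.update_self, Function.update_of_ne (hne ht₁)]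
        exact (hnew t ht₁ hadj.symm b a).symm
      · rw [Function.update_self, Function.update_of_ne (hne hs₁)]
        exact hnew s hs₁ hadj a b
      · rw [Function.update_of_ne (hne hs₁), Function.update_of_ne (hne ht₁)]
        exact (hcomm s hs₁ t ht₁ hadj a b).map i

theorem theorem3p5 {S : Type u} [Finite S] (Γ : SimpleGraph S) (G : S → Type v)
    [∀ s, Group (G s)] (hG : ∀ s, HasFactorizationProperty (G s)) :
    HasFactorizationProperty (GraphProduct Γ G) := by
  intro P _ _ f
  have := Fintype.ofFinite S
  -- The hypotheses only concern finite groups in `Type v`, so `P` is replaced by a copy there.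
  have : Small.{v} P := Countable.toSmall P
  have : Finite (Shrink.{v} P) := Finite.of_equiv P (equivShrink P)
  let e : Shrink.{v} P ≃* P := Shrink.mulEquiv
  let mk : CoprodI G →* GraphProduct Γ G := QuotientGroup.mk' _
  have hmk (s t) (hadj : Γ.Adj s t) (a : G s) (b : G t) :
      Commute (mk (CoprodI.of a)) (mk (CoprodI.of b)) := by
    rw [← commutatorElement_eq_one_iff_commute, ← map_commutatorElement]
    exact (QuotientGroup.eq_one_iff _).2
      (Subgroup.subset_normalClosure ⟨s, t, hadj, a, b, rfl⟩)
  obtain ⟨M, _, hM, hM', h, g, hgh, hcomm⟩ := exists_factorization_of_finset Γ hG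
    (fun s => ((e.symm.toMonoidHom.comp f).comp mk).comp CoprodI.of)
    (fun s t hadj a b => (hmk s t hadj a b).map (e.symm.toMonoidHom.comp f)) Finset.univ
  let d : ULift.{u} M ≃* M := MulEquiv.ulift
  refine ⟨ULift.{u} M, inferInstance, hM.of_injective d.toMonoidHom d.injective,
    hM'.of_mulEquiv_max d, d.symm.toMonoidHom.comp (QuotientGroup.lift _ (CoprodI.lift h) ?_),
    e.toMonoidHom.comp (g.comp d.toMonoidHom), ?_⟩
  · refine Subgroup.normalClosure_le_normal ?_
    rintro _ ⟨s, t, hadj, a, b, rfl⟩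
    rw [SetLike.mem_coe, MonoidHom.mem_ker, map_commutatorElement,
      commutatorElement_eq_one_iff_commute, CoprodI.lift_of, CoprodI.lift_of]
    exact hcomm s (Finset.mem_univ s) t (Finset.mem_univ t) hadj a b
  · refine QuotientGroup.monoidHom_ext _ (CoprodI.ext_hom _ _ fun s => ?_)
    ext a
    have := DFunLike.congr_fun (hgh s (Finset.mem_univ s)) a
    simpa [mk] using (congrArg e this).symm
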